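/- For an irrational real number $\theta$ with simple continued fraction expansion $\theta=[a_0;a_1,a_2,\ldots]$ and an integer $N\ge 1$, arrange the $N+2$ numbers $0,\{\theta\},\{2\theta\},\ldots,\{N\theta\},1$ in increasing order, $0=s_0<s_1<\cdots<s_N<s_{N+1}=1$ (where $\{x\}$ denotes the fractional part of $x$), and let $H(\theta,N)=\max_{0\le i\le N}(s_{i+1}-s_i)$ be the largest gap. For an integer $B\ge 1$, let $\mathcal S_B$ be the set of irrational real numbers $\theta$ whose partial quotients satisfy $a_i\le B$ for all $i\ge 1$, and set $$f(B):=\sup_{\theta\in\mathcal S_B}\ \sup_{N\ge 1}\ N\cdot H(\theta,N).$$ Then for every integer $B\ge 1$ the supremum $f(B)$ is finite, and $$f(B)=\begin{cases}\displaystyle 1+\frac{(a+1)^2}{2\sqrt{a^2+2a}}, & \text{if } B=2a \text{ with an integer } a\ge 1,\\[2ex] \displaystyle 1+\frac{a^2+3a+2}{\sqrt{4a^2+12a+5}}, & \text{if } B=2a+1 \text{ with an integer } a\ge 0.\end{cases}$$ -/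

import Mathlib

/-- The set of irrational real numbers `θ = [a₀; a₁, a₂, …]` (simple continued fraction) all of
whose partial quotients `a₁, a₂, …` are at most `B`.  In Mathlib, `a₀` is the head term of
`GenContFract.of θ`, and `partDens` lists `a₁, a₂, …`. -/
def boundedPartialQuotients (B : ℕ) : Set ℝ :=
  {θ | Irrational θ ∧
    ∀ (i : ℕ) (b : ℝ), (GenContFract.of θ).partDens.get? i = some b → b ≤ (B : ℝ)}

/-- The points `0, {θ}, {2θ}, …, {Nθ}, 1` of the unit interval. -/
def gapPoints (θ : ℝ) (N : ℕ) : Set ℝ :=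
  {x | (∃ n : ℕ, n ≤ N ∧ x = Int.fract ((n : ℝ) * θ)) ∨ x = 1}

/-- The gap set: differences `y - x` of consecutive points `x < y`
among `0, {θ}, {2θ}, …, {Nθ}, 1`. -/
def gapSet (θ : ℝ) (N : ℕ) : Set ℝ :=
  {g | ∃ x ∈ gapPoints θ N, ∃ y ∈ gapPoints θ N,
    x < y ∧ (∀ z ∈ gapPoints θ N, ¬ (x < z ∧ z < y)) ∧ g = y - x}

/-- The length of the largest gap.  The supremum is a maximum: see `isGreatest_largestGap`. -/
noncomputable def largestGap (θ : ℝ) (N : ℕ) : ℝ := sSup (gapSet θ N)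

theorem gapPoints_finite (θ : ℝ) (N : ℕ) : (gapPoints θ N).Finite := by
  have h : gapPoints θ N
      = (fun n : ℕ => Int.fract ((n : ℝ) * θ)) '' Set.Iic N ∪ {1} := by
    ext x
    simp [gapPoints, eq_comm, or_comm]
  rw [h]
  exact ((Set.finite_Iic N).image _).union (Set.finite_singleton 1)

theorem gapSet_finite (θ : ℝ) (N : ℕ) : (gapSet θ N).Finite := by
  refine (Set.Finite.image2 (fun y x : ℝ => y - x)
    (gapPoints_finite θ N) (gapPoints_finite θ N)).subset ?_
  rintro g ⟨x, hx, y, hy, -, -, rfl⟩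
  exact ⟨y, hy, x, hx, rfl⟩

theorem gapSet_nonempty (θ : ℝ) (N : ℕ) : (gapSet θ N).Nonempty := by
  have h0 : (0 : ℝ) ∈ gapPoints θ N := Or.inl ⟨0, Nat.zero_le N, by simp⟩
  have hfin : (gapPoints θ N ∩ Set.Ioi 0).Finite := (gapPoints_finite θ N).inter_of_left _
  have hne : (gapPoints θ N ∩ Set.Ioi 0).Nonempty := ⟨1, Or.inr rfl, Set.mem_Ioi.mpr one_pos⟩
  obtain ⟨y, ⟨hy, hy0⟩, hmin⟩ := Set.exists_min_image _ id hfin hne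
  refine ⟨y - 0, 0, h0, y, hy, hy0, ?_, rfl⟩
  rintro z hz ⟨hz0, hzy⟩
  exact absurd (hmin z ⟨hz, hz0⟩) (not_le.mpr hzy)

theorem isGreatest_largestGap (θ : ℝ) (N : ℕ) : IsGreatest (gapSet θ N) (largestGap θ N) :=
  ⟨(gapSet_nonempty θ N).csSup_mem (gapSet_finite θ N),
    fun _ hg => le_csSup (gapSet_finite θ N).bddAbove hg⟩

/-- The supremum of `N * largestGap θ N` over all irrational `θ` with partial quotients bounded
by `B` and all integers `N ≥ 1`, taken in the extended reals, so that its finiteness is part of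
any claim that it equals a real number. -/
noncomputable def supScaledGap (B : ℕ) : EReal :=
  ⨆ θ ∈ boundedPartialQuotients B, ⨆ (N : ℕ) (_ : 1 ≤ N), (((N : ℝ) * largestGap θ N : ℝ) : EReal)

/-!
Write `q'`, `q` for consecutive denominators of convergents of `θ`, `d'`, `d` for their errors
`|q θ - p|`, and `a` for the next partial quotient. For `1 ≤ m ≤ a` the convergent with denominator
`q` and the intermediate fraction with denominator `m q + q'` form a Farey pair around `θ`, and the
largest gap is the sum of their errors, `d' - (m - 1) d`, as long as
`m q + q' ≤ N + 1 < (m + 1) q + q'` (`largestGap_le`, `le_largestGap`). Hence `N H(θ, N)` is at most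
`((m + 1) q + q' - 2) (d' - (m - 1) d)`, with equality for the last `N` of the block. In terms of
`u = m + x` and `v = a - m + β`, where `x = q' / q = [0; a_k, …, a_1]` and
`β = [0; a_{k+2}, a_{k+3}, …]`, the identity `q d' + q' d = 1` turns this into
`(u + 1 - 2 / q) (v + 1) / (u + v)` (`mul_convErr_eq`).

Without the term `2 / q` this is `1 + (u v + 1) / (u + v)`, which increases in `u` when `v > 1` and
in `v` when `u > 1`. An infinite tail `β` is at most `ξ = [0; 1, B, 1, B, …]`, and the finite tail
`x` exceeds `ξ` by at most `1 / q`, an excess that `2 / q` compensates (`add_one_sub_div_le`). So the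
value is at most the one at `u = m + ξ`, `v = B - m + ξ`, where `u + v = B + 2 ξ = √(B² + 4 B)` and
`u v + 1 = m (B - m) + B + 1`; the best `m` is `⌈B / 2⌉`. If `v ≤ 1`, the value is at most `2`, which
is below the bound when `B ≥ 2`. For `B = 1` only `β = ξ` is possible, the expression decreases in
`u`, and the lower bound for `x` takes the place of the upper one.

The bound is approached for `θ = ξ` along odd `k`, where `a = B` and `β = ξ`, and `x` tends to `ξ`
(`tendsto_mul_convErr`).
-/

/-! ### Convergents from the Gauss map -/

/-- The iterates `{θ}, G {θ}, G² {θ}, …` of the Gauss map `G x = {1/x}`; the `k`-th one is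
`[0; a_{k+1}, a_{k+2}, …]`. -/
noncomputable def gaussIter (θ : ℝ) : ℕ → ℝ
  | 0 => Int.fract θ
  | k + 1 => Int.fract (gaussIter θ k)⁻¹

/-- The partial quotients, shifted by one: `partQuot θ k` is `a_{k+1}`. -/
noncomputable def partQuot (θ : ℝ) (k : ℕ) : ℕ := ⌊(gaussIter θ k)⁻¹⌋₊

/-- The denominators of the convergents, shifted by one: `convDen θ (k + 1)` is `q_k`, and
`convDen θ 0` is `q_{-1} = 0`. -/
noncomputable def convDen (θ : ℝ) : ℕ → ℕ
  | 0 => 0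
  | 1 => 1
  | k + 2 => partQuot θ k * convDen θ (k + 1) + convDen θ k

/-- The numerators of the convergents, shifted by one: `convNum θ (k + 1)` is `p_k`, and
`convNum θ 0` is `p_{-1} = 1`. -/
noncomputable def convNum (θ : ℝ) : ℕ → ℤ
  | 0 => 1
  | 1 => ⌊θ⌋
  | k + 2 => partQuot θ k * convNum θ (k + 1) + convNum θ k

/-- The approximation error `|q θ - p|` of the convergent `p / q` with index `k`, in the shifted
indexing of `convDen` and `convNum`; see `convDen_mul_sub_convNum`. -/
noncomputable def convErr (θ : ℝ) : ℕ → ℝ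
  | 0 => 1
  | k + 1 => gaussIter θ k * convErr θ k

theorem irrational_gaussIter {θ : ℝ} (hθ : Irrational θ) (k : ℕ) :
    Irrational (gaussIter θ k) := by
  induction k with
  | zero => exact hθ.sub_intCast _
  | succ k ih => exact ih.inv.sub_intCast _

theorem gaussIter_nonneg (θ : ℝ) (k : ℕ) : 0 ≤ gaussIter θ k := by
  cases k <;> exact Int.fract_nonneg _

theorem gaussIter_lt_one (θ : ℝ) (k : ℕ) : gaussIter θ k < 1 := by
  cases k <;> exact Int.fract_lt_one _

theorem gaussIter_pos {θ : ℝ} (hθ : Irrational θ) (k : ℕ) : 0 < gaussIter θ k :=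
  (gaussIter_nonneg θ k).lt_of_ne' (irrational_gaussIter hθ k).ne_zero

theorem inv_gaussIter (θ : ℝ) (k : ℕ) :
    (gaussIter θ k)⁻¹ = partQuot θ k + gaussIter θ (k + 1) := by
  have h : (partQuot θ k : ℝ) = ⌊(gaussIter θ k)⁻¹⌋ :=
    natCast_floor_eq_intCast_floor (inv_nonneg.2 (gaussIter_nonneg θ k))
  rw [h]
  exact (Int.floor_add_fract _).symm

theorem gaussIter_mul {θ : ℝ} (hθ : Irrational θ) (k : ℕ) :
    gaussIter θ k * (partQuot θ k + gaussIter θ (k + 1)) = 1 := by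
  rw [← inv_gaussIter, mul_inv_cancel₀ (gaussIter_pos hθ k).ne']

theorem one_le_partQuot {θ : ℝ} (hθ : Irrational θ) (k : ℕ) : 1 ≤ partQuot θ k :=
  Nat.le_floor (by
    simpa using (one_le_inv₀ (gaussIter_pos hθ k)).2 (gaussIter_lt_one θ k).le)

theorem stream_eq {θ : ℝ} (hθ : Irrational θ) (k : ℕ) :
    GenContFract.IntFractPair.stream θ (k + 1) =
      some ⟨(partQuot θ k : ℤ), gaussIter θ (k + 1)⟩ := by
  have hfl (k : ℕ) : (partQuot θ k : ℤ) = ⌊(gaussIter θ k)⁻¹⌋ :=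
    Int.natCast_floor_eq_floor (inv_nonneg.2 (gaussIter_nonneg θ k))
  have key (k : ℕ) : GenContFract.IntFractPair.of (gaussIter θ k)⁻¹ =
      ⟨(partQuot θ k : ℤ), gaussIter θ (k + 1)⟩ := by
    rw [hfl]; rfl
  induction k with
  | zero =>
    rw [← key]
    exact GenContFract.IntFractPair.stream_succ_of_some
      (GenContFract.IntFractPair.stream_zero θ) (gaussIter_pos hθ 0).ne'
  | succ k ih =>
    rw [← key]
    exact GenContFract.IntFractPair.stream_succ_of_some ih (gaussIter_pos hθ (k + 1)).ne'

/-- `partQuot` lists the partial quotients of Mathlib's continued fraction expansion. -/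
theorem partDens_get? {θ : ℝ} (hθ : Irrational θ) (k : ℕ) :
    (GenContFract.of θ).partDens.get? k = some (partQuot θ k : ℝ) := by
  have h := GenContFract.get?_of_eq_some_of_succ_get?_intFractPair_stream (stream_eq hθ k)
  simpa using GenContFract.partDen_eq_s_b h

theorem mem_boundedPartialQuotients_iff {θ : ℝ} {B : ℕ} :
    θ ∈ boundedPartialQuotients B ↔ Irrational θ ∧ ∀ k, partQuot θ k ≤ B := by
  refine and_congr_right fun hθ => ?_
  simp only [partDens_get? hθ, Option.some.injEq]
  exact ⟨fun h k => by exact_mod_cast h k _ rfl, fun h k b hb => by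
    rw [← hb]; exact_mod_cast h k⟩

theorem convErr_pos {θ : ℝ} (hθ : Irrational θ) (k : ℕ) : 0 < convErr θ k := by
  induction k with
  | zero => exact one_pos
  | succ k ih => exact mul_pos (gaussIter_pos hθ k) ih

/-- `D = (a + t') E` for consecutive errors `D`, `E`. -/
theorem convErr_eq {θ : ℝ} (hθ : Irrational θ) (k : ℕ) :
    convErr θ k = (partQuot θ k + gaussIter θ (k + 1)) * convErr θ (k + 1) := by
  rw [convErr, ← mul_assoc, mul_comm (_ + _), gaussIter_mul hθ, one_mul]

theorem convErr_add_two {θ : ℝ} (hθ : Irrational θ) (k : ℕ) :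
    convErr θ (k + 2) = convErr θ k - partQuot θ k * convErr θ (k + 1) := by
  rw [convErr_eq hθ k, convErr]
  ring

theorem convDen_mul_sub_convNum {θ : ℝ} (hθ : Irrational θ) (k : ℕ) :
    convDen θ k * θ - convNum θ k = (-1) ^ (k + 1) * convErr θ k := by
  induction k using Nat.twoStepInduction with
  | zero => simp [convDen, convNum, convErr]
  | one => simp [convDen, convNum, convErr, gaussIter, Int.self_sub_floor]
  | more k h0 h1 =>
    rw [convErr_add_two hθ]
    simp only [convDen, convNum]
    push_cast
    linear_combination (partQuot θ k : ℝ) * h1 + h0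

theorem convNum_mul_convDen_sub (θ : ℝ) (k : ℕ) :
    convNum θ k * convDen θ (k + 1) - convNum θ (k + 1) * convDen θ k = (-1) ^ k := by
  induction k with
  | zero => simp [convDen, convNum]
  | succ k ih =>
    simp only [convDen, convNum]
    push_cast
    linear_combination -ih

theorem convDen_mul_convErr_add {θ : ℝ} (hθ : Irrational θ) (k : ℕ) :
    convDen θ (k + 1) * convErr θ k + convDen θ k * convErr θ (k + 1) = 1 := by
  induction k with
  | zero => simp [convDen, convErr]
  | succ k ih =>
    rw [convErr_add_two hθ]
    simp only [convDen]
    push_cast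
    linear_combination ih

theorem convDen_pos {θ : ℝ} (hθ : Irrational θ) (k : ℕ) : 1 ≤ convDen θ (k + 1) := by
  induction k with
  | zero => exact le_rfl
  | succ k ih =>
    have := Nat.mul_le_mul (one_le_partQuot hθ k) ih
    simp only [convDen]; omega

theorem convDen_add_le {θ : ℝ} (hθ : Irrational θ) (k : ℕ) :
    convDen θ (k + 1) + convDen θ k ≤ convDen θ (k + 2) := by
  have := Nat.mul_le_mul_right (convDen θ (k + 1)) (one_le_partQuot hθ k)
  simp only [convDen]; omega

theorem le_convDen {θ : ℝ} (hθ : Irrational θ) (k : ℕ) : k ≤ convDen θ (k + 1) := by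
  induction k using Nat.twoStepInduction with
  | zero => exact Nat.zero_le _
  | one => exact convDen_pos hθ 1
  | more k _ h1 =>
    have : convDen θ (k + 2) + convDen θ (k + 1) ≤ convDen θ (k + 2 + 1) :=
      convDen_add_le hθ (k + 1)
    have h1 : k + 1 ≤ convDen θ (k + 2) := h1
    have := convDen_pos hθ k
    omega

/-- Every `n ≥ 1` lies in a block `m q + q' ≤ n < (m + 1) q + q'`, where `q'`, `q` are consecutive
denominators and `m` is at least `1` and at most the next partial quotient. -/
theorem exists_convDen_block {θ : ℝ} (hθ : Irrational θ) {n : ℕ} (hn : 1 ≤ n) :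
    ∃ k m : ℕ, 1 ≤ m ∧ m ≤ partQuot θ k ∧ m * convDen θ (k + 1) + convDen θ k ≤ n ∧
      n < (m + 1) * convDen θ (k + 1) + convDen θ k := by
  have hex : ∃ k, n < convDen θ (k + 2) + convDen θ (k + 1) :=
    ⟨n, by
      have : n + 1 ≤ convDen θ (n + 2) := le_convDen hθ (n + 1)
      omega⟩
  classical
  obtain ⟨k, hk, hmin⟩ : ∃ k, n < convDen θ (k + 2) + convDen θ (k + 1) ∧
      convDen θ (k + 1) + convDen θ k ≤ n := by
    refine ⟨Nat.find hex, Nat.find_spec hex, ?_⟩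
    rcases h : Nat.find hex with _ | k
    · simpa [convDen] using hn
    · exact not_lt.1 (Nat.find_min hex (h ▸ Nat.lt_succ_self k))
  have hq := convDen_pos hθ k
  have hlo := Nat.div_mul_le_self (n - convDen θ k) (convDen θ (k + 1))
  have hhi := Nat.lt_div_mul_add (a := n - convDen θ k) (b := convDen θ (k + 1)) hq
  refine ⟨k, (n - convDen θ k) / convDen θ (k + 1), ?_, ?_, by omega, ?_⟩
  · rw [Nat.le_div_iff_mul_le hq]; omega
  · rw [← Nat.lt_succ_iff, Nat.div_lt_iff_lt_mul hq]
    simp only [convDen] at hk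
    rw [Nat.succ_mul]; omega
  · rw [Nat.succ_mul]; omega

/-! ### The largest gap for a Farey pair -/

/-- If `jθ` is congruent to `iθ + e` modulo `1` for some `j ≤ N`, then no gap that starts at `{iθ}`
is longer than `e`: it ends at `{jθ}` or earlier, or else at `1`. -/
theorem gap_le_of_shift {θ e y : ℝ} {N i j : ℕ} {r : ℤ} (hj : j ≤ N) (he : 0 < e)
    (h : (j : ℝ) * θ = i * θ + e + r) (hy : y ∈ gapPoints θ N)
    (hgap : ∀ z ∈ gapPoints θ N, ¬ (Int.fract (i * θ) < z ∧ z < y)) :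
    y ≤ Int.fract (i * θ) + e := by
  by_contra! hlt
  have hy1 : y ≤ 1 := by
    rcases hy with ⟨n, -, rfl⟩ | rfl
    exacts [(Int.fract_lt_one _).le, le_rfl]
  have hfr : Int.fract ((j : ℝ) * θ) = Int.fract (i * θ) + e := by
    rw [Int.fract_eq_iff]
    refine ⟨by have := Int.fract_nonneg ((i : ℝ) * θ); linarith, by linarith,
      ⌊(i : ℝ) * θ⌋ + r, ?_⟩
    rw [h, Int.fract]; push_cast; ring
  exact hgap _ (Or.inl ⟨j, hj, rfl⟩) ⟨by linarith, by linarith⟩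

/-- Let `p / q < θ < p' / q'` with `q, q' ≤ N + 1`. From a point `{iθ}` one of the indices `i + q`,
`i - q'`, `i + q - q'` is admissible, and leads upwards by `e`, `e'` or `e + e'`, where
`e = q θ - p` and `e' = p' - q' θ`. -/
theorem largestGap_le {θ e e' : ℝ} {N q q' : ℕ} {p p' : ℤ} (he : 0 < e) (he' : 0 < e')
    (h : q * θ - p = e) (h' : q' * θ - p' = -e') (hq : q ≤ N + 1) (hq' : q' ≤ N + 1) :
    largestGap θ N ≤ e + e' := by
  obtain ⟨x, hx, y, hy, hxy, hgap, hg⟩ := (isGreatest_largestGap θ N).1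
  rw [hg]
  rcases hx with ⟨i, hi, rfl⟩ | rfl
  · by_cases h1 : i + q ≤ N
    · have := gap_le_of_shift (r := p) h1 he (by push_cast; linarith) hy hgap
      linarith
    by_cases h2 : q' ≤ i
    · have := gap_le_of_shift (j := i - q') (r := -p') (by omega) he'
        (by push_cast [Nat.cast_sub h2]; linarith) hy hgap
      linarith
    · have := gap_le_of_shift (j := i + q - q') (r := p - p') (by omega) (add_pos he he')
        (by push_cast [Nat.cast_sub (by omega : q' ≤ i + q)]; linarith) hy hgap
      linarith
  · have hy1 : y ≤ 1 := by
      rcases hy with ⟨n, -, rfl⟩ | rfl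
      exacts [(Int.fract_lt_one _).le, le_rfl]
    linarith

/-- For a Farey pair `p / q < θ < p' / q'`, a multiple `dθ` with `-q' < d < q` that lies above an
integer `r` lies at least `e + e'` above it. The reason is that `(q, p)` and `(q', p')` form a basis
of `ℤ²`. -/
theorem le_mul_sub_of_det {θ e e' : ℝ} {q q' : ℕ} {p p' : ℤ} (he : 0 < e) (he' : 0 < e')
    (h : q * θ - p = e) (h' : q' * θ - p' = -e') (hdet : p' * q - p * q' = 1)
    {d r : ℤ} (hd : -(q' : ℤ) < d) (hd' : d < q) (hpos : 0 < d * θ - r) :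
    e + e' ≤ d * θ - r := by
  -- `s` and `t` are the coordinates of `(d, r)` in that basis
  obtain ⟨s, hs⟩ : ∃ s, s = d * p' - r * q' := ⟨_, rfl⟩
  obtain ⟨t, ht⟩ : ∃ t, t = r * q - d * p := ⟨_, rfl⟩
  have hdst : d = s * q + t * q' := by rw [hs, ht]; linear_combination -d * hdet
  have hrst : r = s * p + t * p' := by rw [hs, ht]; linear_combination -r * hdet
  have hdisp : d * θ - r = s * e - t * e' := by
    rw [hdst, hrst]; push_cast; linear_combination (s : ℝ) * h + (t : ℝ) * h'
  rw [hdisp] at hpos ⊢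
  have hq0 : (0 : ℤ) ≤ q := Int.natCast_nonneg q
  have hq0' : (0 : ℤ) ≤ q' := Int.natCast_nonneg q'
  rcases le_or_gt s 0 with hs0 | hs0
  · exfalso
    have ht1 : t < 0 := by
      by_contra! ht0
      have : (s : ℝ) * e ≤ 0 := mul_nonpos_of_nonpos_of_nonneg (by exact_mod_cast hs0) he.le
      have : 0 ≤ (t : ℝ) * e' := mul_nonneg (by exact_mod_cast ht0) he'.le
      linarith
    nlinarith
  · have ht1 : t < 0 := by
      by_contra! ht0
      nlinarith
    have h1 : (1 : ℝ) ≤ s := by exact_mod_cast hs0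
    have h2 : (t : ℝ) ≤ -1 := by exact_mod_cast (by omega : t ≤ -1)
    nlinarith

/-- For a Farey pair `p / q < θ < p' / q'` the bound of `largestGap_le` is attained as long as
`N + 1 < q + q'`; the gap after `{(q' - 1)θ}` shows this for the largest such `N`. -/
theorem le_largestGap {θ e e' : ℝ} {N q q' : ℕ} {p p' : ℤ} (he : 0 < e) (he' : 0 < e')
    (h : q * θ - p = e) (h' : q' * θ - p' = -e') (hdet : p' * q - p * q' = 1)
    (hq : 1 ≤ q) (hq' : 1 ≤ q') (hN : N + 2 = q + q') :
    e + e' ≤ largestGap θ N := by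
  obtain ⟨i, hi⟩ : ∃ i : ℕ, i + 1 = q' := ⟨q' - 1, by omega⟩
  have hfin : (gapPoints θ N ∩ Set.Ioi (Int.fract (i * θ))).Finite :=
    (gapPoints_finite θ N).inter_of_left _
  obtain ⟨y, ⟨hy, hxy⟩, hmin⟩ := Set.exists_min_image _ id hfin
    ⟨1, Or.inr rfl, Set.mem_Ioi.2 (Int.fract_lt_one _)⟩
  have hmem : y - Int.fract (i * θ) ∈ gapSet θ N :=
    ⟨_, Or.inl ⟨i, by omega, rfl⟩, y, hy, hxy,
      fun z hz hz' => absurd (hmin z ⟨hz, hz'.1⟩) (not_le.2 hz'.2), rfl⟩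
  refine le_trans ?_ ((isGreatest_largestGap θ N).2 hmem)
  have hxy : Int.fract (i * θ) < y := hxy
  -- the point `1` is the point `0` with a different integer part
  obtain ⟨j, r, hj, hyj⟩ : ∃ (j : ℕ) (r : ℤ), j ≤ N ∧ y = j * θ - r := by
    rcases hy with ⟨j, hj, rfl⟩ | rfl
    · exact ⟨j, ⌊(j : ℝ) * θ⌋, hj, rfl⟩
    · exact ⟨0, -1, by omega, by simp⟩
  have heq : y - Int.fract (i * θ) = ((j - i : ℤ) : ℝ) * θ - ((r - ⌊(i : ℝ) * θ⌋ : ℤ) : ℝ) := by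
    rw [hyj, Int.fract]; push_cast; ring
  rw [heq]
  refine le_mul_sub_of_det he he' h h' hdet (by omega) (by omega) ?_
  rw [← heq]; linarith

/-! ### The extremal tails and the optimization -/

/-- `[0; 1, B, 1, B, …]`, the largest value of a continued fraction `[0; b₁, b₂, …]` whose partial
quotients are at most `B`. -/
noncomputable def maxTail (B : ℕ) : ℝ := (√((B : ℝ) ^ 2 + 4 * B) - B) / 2

/-- `[0; B, 1, B, 1, …]`, the smallest value of a continued fraction `[0; b₁, b₂, …]` whose partial
quotients are at most `B`. -/
noncomputable def minTail (B : ℕ) : ℝ := maxTail B / B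

/-- The claimed value of the supremum, for both parities of `B` at once. The first summand of the
numerator is the maximum of `m (B - m)` over integers `m`. -/
noncomputable def scaledGapBound (B : ℕ) : ℝ :=
  1 + ((B / 2 * ((B + 1) / 2) : ℕ) + B + 1) / √((B : ℝ) ^ 2 + 4 * B)

theorem sqrt_eq_maxTail (B : ℕ) : √((B : ℝ) ^ 2 + 4 * B) = B + 2 * maxTail B := by
  rw [maxTail]; ring

theorem maxTail_sq (B : ℕ) : maxTail B ^ 2 + B * maxTail B = B := by
  have h := Real.sq_sqrt (show (0 : ℝ) ≤ (B : ℝ) ^ 2 + 4 * B by positivity)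
  rw [sqrt_eq_maxTail] at h
  linear_combination h / 4

theorem maxTail_pos {B : ℕ} (hB : 1 ≤ B) : 0 < maxTail B := by
  have hB' : (1 : ℝ) ≤ B := by exact_mod_cast hB
  have : (B : ℝ) < √((B : ℝ) ^ 2 + 4 * B) := Real.lt_sqrt_of_sq_lt (by linarith)
  rw [maxTail]; linarith

theorem maxTail_lt_one {B : ℕ} (hB : 1 ≤ B) : maxTail B < 1 := by
  have hB' : (1 : ℝ) ≤ B := by exact_mod_cast hB
  have := maxTail_pos hB
  have := maxTail_sq B
  nlinarith

theorem minTail_pos {B : ℕ} (hB : 1 ≤ B) : 0 < minTail B :=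
  div_pos (maxTail_pos hB) (by exact_mod_cast hB)

theorem maxTail_mul {B : ℕ} (hB : 1 ≤ B) : maxTail B * (1 + minTail B) = 1 := by
  have hB' : (B : ℝ) ≠ 0 := by positivity
  have := maxTail_sq B
  rw [minTail]; field_simp; linarith

theorem minTail_mul {B : ℕ} (hB : 1 ≤ B) : minTail B * (B + maxTail B) = 1 := by
  have hB' : (B : ℝ) ≠ 0 := by positivity
  have := maxTail_sq B
  rw [minTail]; field_simp; linarith

theorem minTail_le_maxTail {B : ℕ} (hB : 1 ≤ B) : minTail B ≤ maxTail B :=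
  div_le_self (maxTail_pos hB).le (by exact_mod_cast hB)

theorem irrational_maxTail {B : ℕ} (hB : 1 ≤ B) : Irrational (maxTail B) := by
  have h : Irrational √((B ^ 2 + 4 * B : ℕ) : ℝ) := by
    rw [irrational_sqrt_natCast_iff]
    rintro ⟨r, hr⟩
    have h1 : B + 1 < r := by nlinarith
    have h2 : r < B + 2 := by nlinarith
    omega
  push_cast at h
  rw [sqrt_eq_maxTail] at h
  intro ⟨c, hc⟩
  exact h ⟨B + 2 * c, by push_cast; rw [hc]⟩

/-- The value of `(u + 1)(v + 1) / (u + v)` at the extremal point for the splitting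
`B = m + (B - m)`. -/
theorem extremal_value {B : ℕ} (hB : 1 ≤ B) (m : ℝ) :
    (m + maxTail B + 1) * (B - m + maxTail B + 1) / ((m + maxTail B) + (B - m + maxTail B)) =
      1 + (m * (B - m) + B + 1) / (B + 2 * maxTail B) := by
  have h1 := maxTail_pos hB
  have h2 : (0 : ℝ) < B + 2 * maxTail B := by positivity
  have h3 : (m + maxTail B) + (B - m + maxTail B) = B + 2 * maxTail B := by ring
  rw [h3]
  field_simp
  linear_combination maxTail_sq B

theorem mul_sub_le_half_mul {B m : ℕ} (hm : m ≤ B) :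
    (m : ℝ) * (B - m) ≤ (B / 2 * ((B + 1) / 2) : ℕ) := by
  have key : m * (B - m) ≤ B / 2 * ((B + 1) / 2) := by
    obtain ⟨l, rfl⟩ := Nat.exists_eq_add_of_le hm
    rw [Nat.add_sub_cancel_left]
    rcases Nat.even_or_odd' (m + l) with ⟨b, hb | hb⟩
    · rw [show (m + l) / 2 = b by omega, show (m + l + 1) / 2 = b by omega]
      zify at hb ⊢
      nlinarith [sq_nonneg ((m : ℤ) - l)]
    · rw [show (m + l) / 2 = b by omega, show (m + l + 1) / 2 = b + 1 by omega]
      have hne : 1 ≤ ((m : ℤ) - l) ^ 2 := by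
        have : (m : ℤ) - l ≠ 0 := by omega
        have := sq_pos_of_ne_zero this
        omega
      zify at hb ⊢
      nlinarith
  rw [← Nat.cast_sub hm]
  exact_mod_cast key

theorem extremal_value_le {B m : ℕ} (hB : 1 ≤ B) (hm : m ≤ B) :
    ((m : ℝ) + maxTail B + 1) * (B - m + maxTail B + 1) /
      ((m + maxTail B) + (B - m + maxTail B)) ≤ scaledGapBound B := by
  have := maxTail_pos hB
  rw [extremal_value hB, scaledGapBound, sqrt_eq_maxTail]
  gcongr
  exact mul_sub_le_half_mul hm

theorem two_le_scaledGapBound {B : ℕ} (hB : 2 ≤ B) : 2 ≤ scaledGapBound B := by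
  have h0 := maxTail_pos (B := B) (by omega)
  have h1 := maxTail_lt_one (B := B) (by omega)
  have h2 : (1 : ℝ) ≤ (B / 2 * ((B + 1) / 2) : ℕ) := by
    exact_mod_cast Nat.mul_pos (by omega : 0 < B / 2) (by omega)
  have h3 : 1 ≤ (((B / 2 * ((B + 1) / 2) : ℕ) : ℝ) + B + 1) / (B + 2 * maxTail B) := by
    rw [one_le_div (by positivity)]; linarith
  rw [scaledGapBound, sqrt_eq_maxTail]; linarith

/-- The factor `u + 1 - 2s` in place of `u + 1` absorbs an error of size `s` in `u`. -/
theorem add_one_sub_div_le {u U v s : ℝ} (hu : 0 < u) (hU : 1 ≤ U) (hv : 0 < v)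
    (h : (u - U) * (v - 1) ≤ s * (2 * (U + v))) :
    (u + 1 - 2 * s) / (u + v) ≤ (U + 1) / (U + v) := by
  rw [div_le_div_iff₀ (by linarith) (by linarith)]
  linarith

theorem add_one_div_le {U v V : ℝ} (hU : 1 ≤ U) (hv : 0 < v) (h : v ≤ V) :
    (v + 1) / (U + v) ≤ (V + 1) / (U + V) := by
  rw [div_le_div_iff₀ (by linarith) (by linarith)]
  nlinarith

/-- The upper bound, in terms of the ratio `x` of consecutive denominators, the tail `β`, and the
reciprocal `s` of a denominator. -/
theorem scaledGap_le_bound {B a m : ℕ} {x β s : ℝ} (hm : 1 ≤ m) (hma : m ≤ a) (haB : a ≤ B)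
    (hx : 0 ≤ x) (hs : 0 ≤ s) (hβ : minTail B ≤ β) (hβ' : β ≤ maxTail B)
    (hxs : x ≤ maxTail B + s) (hxs' : minTail B ≤ x + s) :
    (m + x + 1 - 2 * s) * (a - m + β + 1) / ((m + x) + (a - m + β)) ≤ scaledGapBound B := by
  have hB : 1 ≤ B := by omega
  have hβ0 : 0 < β := (minTail_pos hB).trans_le hβ
  have hξ := maxTail_pos hB
  have hm' : (1 : ℝ) ≤ m := by exact_mod_cast hm
  have hma' : (m : ℝ) ≤ a := by exact_mod_cast hma
  have haB' : (a : ℝ) ≤ B := by exact_mod_cast haB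
  have hv0 : 0 < (a : ℝ) - m + β := by linarith
  have step (hU : ((m + x) - (m + maxTail B)) * ((a - m + β) - 1) ≤
      s * (2 * ((m + maxTail B) + (a - m + β)))) :
      (m + x + 1 - 2 * s) * (a - m + β + 1) / ((m + x) + (a - m + β)) ≤ scaledGapBound B := by
    refine le_trans ?_ (extremal_value_le hB (hma.trans haB))
    have h1 := add_one_sub_div_le (by linarith) (by linarith) hv0 hU
    have h2 := add_one_div_le (U := m + maxTail B) (V := B - m + maxTail B) (by linarith) hv0
      (by linarith)
    calc _ = (m + x + 1 - 2 * s) / ((m + x) + (a - m + β)) * (a - m + β + 1) := by ring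
      _ ≤ (m + maxTail B + 1) / ((m + maxTail B) + (a - m + β)) * (a - m + β + 1) := by gcongr
      _ = (m + maxTail B + 1) * ((a - m + β + 1) / ((m + maxTail B) + (a - m + β))) := by ring
      _ ≤ (m + maxTail B + 1) *
          ((B - m + maxTail B + 1) / ((m + maxTail B) + (B - m + maxTail B))) := by gcongr
      _ = _ := by ring
  rcases hB.eq_or_lt with rfl | hB2
  · -- for `B = 1` the two extremal tails coincide, and the expression decreases in `x`
    have hmm : minTail 1 = maxTail 1 := by simp [minTail]
    obtain rfl : m = 1 := by omega
    obtain rfl : a = 1 := by omega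
    apply step
    have := maxTail_lt_one hB
    push_cast
    nlinarith
  rcases le_total ((a : ℝ) - m + β) 1 with hv | hv
  · refine le_trans ?_ (two_le_scaledGapBound hB2)
    rw [div_le_iff₀ (by linarith)]
    nlinarith
  · apply step
    nlinarith

/-! ### Gaps in terms of convergents -/

theorem partQuot_mul_convErr_lt {θ : ℝ} (hθ : Irrational θ) {k m : ℕ} (hma : m ≤ partQuot θ k) :
    (m : ℝ) * convErr θ (k + 1) < convErr θ k := by
  have h1 := convErr_pos hθ (k + 2)
  have h2 := mul_le_mul_of_nonneg_right (Nat.cast_le (α := ℝ).2 hma) (convErr_pos hθ (k + 1)).le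
  rw [convErr_add_two hθ] at h1
  linarith

/-- The convergent with index `k + 1` and the intermediate fraction with denominator
`m q_k + q_{k-1}` enclose `θ`; on which side depends on the parity of `k`. -/
theorem intermediate_sub {θ : ℝ} (hθ : Irrational θ) (k m : ℕ) :
    ((m * convDen θ (k + 1) + convDen θ k : ℕ) : ℝ) * θ -
      ((m * convNum θ (k + 1) + convNum θ k : ℤ) : ℝ) =
        (-1) ^ (k + 1) * (convErr θ k - m * convErr θ (k + 1)) := by
  push_cast
  linear_combination (m : ℝ) * convDen_mul_sub_convNum hθ (k + 1) + convDen_mul_sub_convNum hθ k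

theorem largestGap_le_convErr {θ : ℝ} (hθ : Irrational θ) {N k m : ℕ} (hm : 1 ≤ m)
    (hma : m ≤ partQuot θ k) (hN : m * convDen θ (k + 1) + convDen θ k ≤ N + 1) :
    largestGap θ N ≤ convErr θ k - (m - 1) * convErr θ (k + 1) := by
  have he := convErr_pos hθ (k + 1)
  have he' := sub_pos.2 (partQuot_mul_convErr_lt hθ hma)
  have h := convDen_mul_sub_convNum hθ (k + 1)
  have h' := intermediate_sub hθ k m
  have hq := Nat.mul_le_mul_right (convDen θ (k + 1)) hm
  rcases k.even_or_odd with hk | hk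
  · rw [hk.add_one.add_one.neg_one_pow, one_mul] at h
    rw [hk.add_one.neg_one_pow, neg_one_mul] at h'
    have := largestGap_le (N := N) he he' h h' (by omega) (by omega)
    linarith
  · rw [hk.add_one.add_one.neg_one_pow, neg_one_mul] at h
    rw [hk.add_one.neg_one_pow, one_mul] at h'
    have := largestGap_le (N := N) he' he h' h (by omega) (by omega)
    linarith

theorem convErr_le_largestGap {θ : ℝ} (hθ : Irrational θ) {N k m : ℕ} (hm : 1 ≤ m)
    (hma : m ≤ partQuot θ k) (hN : N + 2 = (m + 1) * convDen θ (k + 1) + convDen θ k) :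
    convErr θ k - (m - 1) * convErr θ (k + 1) ≤ largestGap θ N := by
  have he := convErr_pos hθ (k + 1)
  have he' := sub_pos.2 (partQuot_mul_convErr_lt hθ hma)
  have h := convDen_mul_sub_convNum hθ (k + 1)
  have h' := intermediate_sub hθ k m
  have hdet := convNum_mul_convDen_sub θ k
  have hpos := convDen_pos hθ k
  have hq := Nat.mul_le_mul_right (convDen θ (k + 1)) hm
  rw [Nat.succ_mul] at hN
  rcases k.even_or_odd with hk | hk
  · rw [hk.add_one.add_one.neg_one_pow, one_mul] at h
    rw [hk.add_one.neg_one_pow, neg_one_mul] at h'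
    rw [hk.neg_one_pow] at hdet
    have := le_largestGap (N := N) he he' h h' (by push_cast; linear_combination hdet)
      (by omega) (by omega) (by omega)
    linarith
  · rw [hk.add_one.add_one.neg_one_pow, neg_one_mul] at h
    rw [hk.add_one.neg_one_pow, one_mul] at h'
    rw [hk.neg_one_pow] at hdet
    have := le_largestGap (N := N) he' he h' h (by push_cast; linear_combination -hdet)
      (by omega) (by omega) (by omega)
    linarith

/-! ### The upper bound -/

/-- `N` times the gap length, in terms of `u = m + x` and `v = a - m + β`, where `x` is the ratio
of consecutive denominators and `β` the next iterate of the Gauss map. -/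
theorem mul_convErr_eq {θ : ℝ} (hθ : Irrational θ) (k m : ℕ) :
    ((m + 1) * convDen θ (k + 1) + convDen θ k - 2) *
        (convErr θ k - (m - 1) * convErr θ (k + 1)) =
      (m + convDen θ k / convDen θ (k + 1) + 1 - 2 * (1 / convDen θ (k + 1))) *
          (partQuot θ k - m + gaussIter θ (k + 1) + 1) /
        ((m + convDen θ k / convDen θ (k + 1)) + (partQuot θ k - m + gaussIter θ (k + 1))) := by
  have hq : (0 : ℝ) < convDen θ (k + 1) := by exact_mod_cast convDen_pos hθ k
  have ha : (0 : ℝ) < partQuot θ k := by exact_mod_cast one_le_partQuot hθ k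
  have ht := gaussIter_nonneg θ (k + 1)
  have hid := convDen_mul_convErr_add hθ k
  rw [convErr_eq hθ k] at hid ⊢
  have hS : (m : ℝ) + convDen θ k / convDen θ (k + 1) + (partQuot θ k - m + gaussIter θ (k + 1)) =
      (convDen θ (k + 1) * (partQuot θ k + gaussIter θ (k + 1)) + convDen θ k) /
        convDen θ (k + 1) := by
    field_simp; ring
  have hpos : 0 < convDen θ (k + 1) * (partQuot θ k + gaussIter θ (k + 1)) + convDen θ k := by
    positivity
  have hE : convErr θ (k + 1) =
      1 / (convDen θ (k + 1) * (partQuot θ k + gaussIter θ (k + 1)) + convDen θ k) := by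
    rw [eq_div_iff hpos.ne']; linear_combination hid
  rw [hS, hE]
  field_simp
  ring

/-- Consecutive denominators satisfy `η q - 1 ≤ q' ≤ ξ q + 1`, where `ξ` and `η` are the largest
and the smallest tail; the two linear inequalities support each other in the induction. -/
theorem convDen_ratio_bounds {θ : ℝ} {B : ℕ} (hB : 1 ≤ B)
    (hθ : θ ∈ boundedPartialQuotients B) (k : ℕ) :
    (convDen θ k : ℝ) - maxTail B * convDen θ (k + 1) ≤ 1 ∧
      minTail B * convDen θ (k + 1) - convDen θ k ≤ 1 := by
  rw [mem_boundedPartialQuotients_iff] at hθ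
  have hξ := maxTail_pos hB
  have hη := minTail_pos hB
  have hξ1 := maxTail_lt_one hB
  have hη1 := minTail_le_maxTail hB
  have e1 := maxTail_mul hB
  have e2 := minTail_mul hB
  induction k with
  | zero => constructor <;> simp [convDen] <;> linarith
  | succ k ih =>
    obtain ⟨i1, i2⟩ := ih
    have ha : (1 : ℝ) ≤ partQuot θ k := by exact_mod_cast one_le_partQuot hθ.1 k
    have haB : (partQuot θ k : ℝ) ≤ B := by exact_mod_cast hθ.2 k
    have hq : (0 : ℝ) ≤ convDen θ (k + 1) := Nat.cast_nonneg _
    simp only [convDen]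
    push_cast
    constructor
    · have h1 := mul_le_mul_of_nonneg_left i2 hξ.le
      have h2 := mul_le_mul_of_nonneg_left (mul_le_mul_of_nonneg_right ha hq) hξ.le
      have h3 : maxTail B * (minTail B * convDen θ (k + 1)) =
          (1 - maxTail B) * convDen θ (k + 1) := by
        linear_combination (convDen θ (k + 1) : ℝ) * e1
      linarith
    · have h1 := mul_le_mul_of_nonneg_left i1 hη.le
      have h2 := mul_le_mul_of_nonneg_left (mul_le_mul_of_nonneg_right haB hq) hη.le
      have h3 : minTail B * (maxTail B * convDen θ (k + 1)) =
          (1 - minTail B * B) * convDen θ (k + 1) := by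
        linear_combination (convDen θ (k + 1) : ℝ) * e2
      linarith

theorem convDen_div_bounds {θ : ℝ} {B : ℕ} (hB : 1 ≤ B)
    (hθ : θ ∈ boundedPartialQuotients B) (k : ℕ) :
    (convDen θ k / convDen θ (k + 1) : ℝ) ≤ maxTail B + 1 / convDen θ (k + 1) ∧
      minTail B ≤ (convDen θ k / convDen θ (k + 1) : ℝ) + 1 / convDen θ (k + 1) := by
  have hq : (0 : ℝ) < convDen θ (k + 1) := by exact_mod_cast convDen_pos hθ.1 k
  obtain ⟨h1, h2⟩ := convDen_ratio_bounds hB hθ k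
  constructor
  · rw [← sub_le_iff_le_add, ← sub_div, div_le_iff₀ hq]; linarith
  · rw [← add_div, le_div_iff₀ hq]; linarith

/-- The iterates of the Gauss map lie between the extremal tails: one application of
`t = 1 / (a + t')` contracts the possible violation by the factor `1 / (1 + η)`. -/
theorem gaussIter_bounds {θ : ℝ} {B : ℕ} (hB : 1 ≤ B)
    (hθ : θ ∈ boundedPartialQuotients B) (k : ℕ) :
    minTail B ≤ gaussIter θ k ∧ gaussIter θ k ≤ maxTail B := by
  rw [mem_boundedPartialQuotients_iff] at hθ
  have hξ := maxTail_pos hB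
  have hη := minTail_pos hB
  have hξ1 := maxTail_lt_one hB
  have hη1 := minTail_le_maxTail hB
  have e1 := maxTail_mul hB
  have e2 := minTail_mul hB
  -- `ξ = 1 / (1 + η)` is the contraction factor
  have key (n : ℕ) : ∀ k, minTail B - gaussIter θ k ≤ maxTail B ^ n ∧
      gaussIter θ k - maxTail B ≤ maxTail B ^ n := by
    induction n with
    | zero =>
      intro k
      have := gaussIter_lt_one θ k
      have := gaussIter_nonneg θ k
      rw [pow_zero]
      constructor <;> linarith
    | succ n ih =>
      intro k
      obtain ⟨i1, i2⟩ := ih (k + 1)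
      have ha : (1 : ℝ) ≤ partQuot θ k := by exact_mod_cast one_le_partQuot hθ.1 k
      have haB : (partQuot θ k : ℝ) ≤ B := by exact_mod_cast hθ.2 k
      have ht := gaussIter_pos hθ.1 k
      have ht1 := gaussIter_lt_one θ k
      have e3 := gaussIter_mul hθ.1 k
      have hp := pow_pos hξ n
      set t := gaussIter θ k
      set t' := gaussIter θ (k + 1)
      set a := (partQuot θ k : ℝ)
      rw [pow_succ']
      constructor
      · have h1 : minTail B - t = minTail B * t * ((a - B) + (t' - maxTail B)) := by
          linear_combination t * e2 - minTail B * e3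
        rw [h1]
        calc minTail B * t * ((a - B) + (t' - maxTail B))
            ≤ minTail B * t * maxTail B ^ n := by gcongr; linarith
          _ ≤ maxTail B * maxTail B ^ n := by gcongr; nlinarith
      · have h1 : t - maxTail B = maxTail B * t * ((1 - a) + (minTail B - t')) := by
          linear_combination maxTail B * e3 - t * e1
        rw [h1]
        calc maxTail B * t * ((1 - a) + (minTail B - t'))
            ≤ maxTail B * t * maxTail B ^ n := by gcongr; linarith
          _ ≤ maxTail B * maxTail B ^ n := by gcongr; nlinarith
  have hlim := tendsto_pow_atTop_nhds_zero_of_lt_one hξ.le hξ1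
  exact ⟨sub_nonpos.1 (ge_of_tendsto' hlim fun n => (key n k).1),
    sub_nonpos.1 (ge_of_tendsto' hlim fun n => (key n k).2)⟩

theorem mul_largestGap_le {θ : ℝ} {B : ℕ} (hB : 1 ≤ B) (hθ : θ ∈ boundedPartialQuotients B)
    (N : ℕ) : (N : ℝ) * largestGap θ N ≤ scaledGapBound B := by
  obtain ⟨k, m, hm, hma, hlo, hhi⟩ := exists_convDen_block hθ.1 (Nat.le_add_left 1 N)
  have hgap := largestGap_le_convErr hθ.1 hm hma hlo
  have hNle : (N : ℝ) ≤ (m + 1) * convDen θ (k + 1) + convDen θ k - 2 := by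
    have : ((N + 2 : ℕ) : ℝ) ≤ ((m + 1) * convDen θ (k + 1) + convDen θ k : ℕ) :=
      Nat.cast_le.2 (by omega)
    push_cast at this
    linarith
  have hpos : 0 ≤ convErr θ k - (m - 1) * convErr θ (k + 1) := by
    have := partQuot_mul_convErr_lt hθ.1 hma
    have := convErr_pos hθ.1 (k + 1)
    linarith
  obtain ⟨hx1, hx2⟩ := convDen_div_bounds hB hθ k
  obtain ⟨hb1, hb2⟩ := gaussIter_bounds hB hθ (k + 1)
  calc (N : ℝ) * largestGap θ N
      ≤ N * (convErr θ k - (m - 1) * convErr θ (k + 1)) := by gcongr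
    _ ≤ ((m + 1) * convDen θ (k + 1) + convDen θ k - 2) *
        (convErr θ k - (m - 1) * convErr θ (k + 1)) := by gcongr
    _ ≤ scaledGapBound B := by
      rw [mul_convErr_eq hθ.1]
      exact scaledGap_le_bound hm hma ((mem_boundedPartialQuotients_iff.1 hθ).2 k)
        (by positivity) (by positivity) hb1 hb2 hx1 hx2

/-! ### The extremal number -/

theorem floor_fract_of_inv_eq {x y : ℝ} {a : ℕ} (h : x⁻¹ = a + y) (h0 : 0 ≤ y) (h1 : y < 1) :
    ⌊x⁻¹⌋₊ = a ∧ Int.fract x⁻¹ = y := by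
  rw [h]
  refine ⟨?_, ?_⟩
  · rw [add_comm, Nat.floor_add_natCast h0, Nat.floor_eq_zero.2 h1, zero_add]
  · rw [Int.fract_natCast_add, Int.fract_eq_self.2 ⟨h0, h1⟩]

theorem gaussIter_maxTail {B : ℕ} (hB : 1 ≤ B) (j : ℕ) :
    gaussIter (maxTail B) (2 * j) = maxTail B ∧
      gaussIter (maxTail B) (2 * j + 1) = minTail B := by
  have hξ := maxTail_pos hB
  have hη := minTail_pos hB
  have hξ1 := maxTail_lt_one hB
  have hη1 := minTail_le_maxTail hB
  have s1 : Int.fract (maxTail B)⁻¹ = minTail B :=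
    (floor_fract_of_inv_eq (a := 1) (by
      rw [inv_eq_of_mul_eq_one_right (maxTail_mul hB)]; norm_num) hη.le (by linarith)).2
  have s2 : Int.fract (minTail B)⁻¹ = maxTail B :=
    (floor_fract_of_inv_eq (inv_eq_of_mul_eq_one_right (minTail_mul hB)) hξ.le hξ1).2
  induction j with
  | zero =>
    have h0 : gaussIter (maxTail B) 0 = maxTail B := Int.fract_eq_self.2 ⟨hξ.le, hξ1⟩
    exact ⟨h0, by rw [gaussIter, Nat.mul_zero, h0, s1]⟩
  | succ j ih =>
    have h0 : gaussIter (maxTail B) (2 * (j + 1)) = maxTail B := by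
      rw [Nat.mul_succ, gaussIter, ih.2, s2]
    exact ⟨h0, by rw [gaussIter, h0, s1]⟩

theorem partQuot_maxTail {B : ℕ} (hB : 1 ≤ B) (j : ℕ) :
    partQuot (maxTail B) (2 * j) = 1 ∧ partQuot (maxTail B) (2 * j + 1) = B := by
  have hξ1 := maxTail_lt_one hB
  have hη1 := minTail_le_maxTail hB
  rw [partQuot, partQuot, (gaussIter_maxTail hB j).1, (gaussIter_maxTail hB j).2]
  exact ⟨(floor_fract_of_inv_eq (by
      rw [inv_eq_of_mul_eq_one_right (maxTail_mul hB)]; norm_num) (minTail_pos hB).le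
      (by linarith)).1,
    (floor_fract_of_inv_eq (inv_eq_of_mul_eq_one_right (minTail_mul hB))
      (maxTail_pos hB).le hξ1).1⟩

theorem maxTail_mem {B : ℕ} (hB : 1 ≤ B) : maxTail B ∈ boundedPartialQuotients B := by
  refine mem_boundedPartialQuotients_iff.2 ⟨irrational_maxTail hB, fun k => ?_⟩
  obtain ⟨j, rfl | rfl⟩ := k.even_or_odd'
  · rw [(partQuot_maxTail hB j).1]; exact hB
  · rw [(partQuot_maxTail hB j).2]

/-- For `θ = [0; 1, B, 1, B, …]` the deviations `q' - η q` and `q' - ξ q` of consecutive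
denominators arise from each other by multiplication by `-ξ` and `-η`, hence stay bounded. -/
theorem abs_convDen_sub_le {B : ℕ} (hB : 1 ≤ B) (j : ℕ) :
    |(convDen (maxTail B) (2 * j) : ℝ) - minTail B * convDen (maxTail B) (2 * j + 1)| ≤ 1 ∧
      |(convDen (maxTail B) (2 * j + 1) : ℝ) - maxTail B * convDen (maxTail B) (2 * j + 2)| ≤
        1 := by
  have hξ := maxTail_pos hB
  have hη := minTail_pos hB
  have hξ1 := maxTail_lt_one hB
  have hη1 := minTail_le_maxTail hB
  have e1 := maxTail_mul hB
  have e2 := minTail_mul hB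
  have mul_le {r y : ℝ} (hr : 0 < r) (hr1 : r ≤ 1) (hy : |y| ≤ 1) : |-r * y| ≤ 1 := by
    rw [abs_mul, abs_neg, abs_of_pos hr]
    exact mul_le_one₀ hr1 (abs_nonneg _) hy
  have odd_of_even (j : ℕ) : (convDen (maxTail B) (2 * j + 1) : ℝ) -
      maxTail B * convDen (maxTail B) (2 * j + 2) = -maxTail B *
        (convDen (maxTail B) (2 * j) - minTail B * convDen (maxTail B) (2 * j + 1)) := by
    simp only [convDen, (partQuot_maxTail hB j).1]
    push_cast
    linear_combination -(convDen (maxTail B) (2 * j + 1) : ℝ) * e1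
  have even_of_odd (j : ℕ) : (convDen (maxTail B) (2 * j + 2) : ℝ) -
      minTail B * convDen (maxTail B) (2 * j + 3) = -minTail B *
        (convDen (maxTail B) (2 * j + 1) - maxTail B * convDen (maxTail B) (2 * j + 2)) := by
    have h : convDen (maxTail B) (2 * j + 3) =
        partQuot (maxTail B) (2 * j + 1) * convDen (maxTail B) (2 * j + 2) +
          convDen (maxTail B) (2 * j + 1) := rfl
    rw [h, (partQuot_maxTail hB j).2]
    push_cast
    linear_combination -(convDen (maxTail B) (2 * j + 2) : ℝ) * e2
  suffices h : |(convDen (maxTail B) (2 * j) : ℝ) -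
      minTail B * convDen (maxTail B) (2 * j + 1)| ≤ 1 from
    ⟨h, by rw [odd_of_even]; exact mul_le hξ hξ1.le h⟩
  induction j with
  | zero => simp [convDen, abs_of_pos hη]; linarith
  | succ j ih =>
    rw [Nat.mul_succ, even_of_odd, odd_of_even]
    exact mul_le hη (by linarith) (mul_le hξ hξ1.le ih)

theorem tendsto_inv_convDen {θ : ℝ} (hθ : Irrational θ) :
    Filter.Tendsto (fun j : ℕ => 1 / (convDen θ (2 * j + 2) : ℝ)) Filter.atTop (nhds 0) := by
  simp only [one_div]
  refine (tendsto_natCast_atTop_atTop.comp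
    (Filter.tendsto_atTop_mono (fun j => ?_) Filter.tendsto_id)).inv_tendsto_atTop
  have : 2 * j + 1 ≤ convDen θ (2 * j + 2) := le_convDen hθ (2 * j + 1)
  simp only [id]; omega

theorem tendsto_convDen_div {B : ℕ} (hB : 1 ≤ B) :
    Filter.Tendsto (fun j : ℕ =>
      (convDen (maxTail B) (2 * j + 1) / convDen (maxTail B) (2 * j + 2) : ℝ))
      Filter.atTop (nhds (maxTail B)) := by
  rw [tendsto_iff_norm_sub_tendsto_zero]
  refine squeeze_zero (fun _ => norm_nonneg _) (fun j => ?_)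
    (tendsto_inv_convDen (irrational_maxTail hB))
  have hq : (0 : ℝ) < convDen (maxTail B) (2 * j + 2) := by
    exact_mod_cast convDen_pos (irrational_maxTail hB) (2 * j + 1)
  rw [Real.norm_eq_abs, le_div_iff₀ hq]
  nth_rw 2 [← abs_of_pos hq]
  rw [← abs_mul, sub_mul, div_mul_cancel₀ _ hq.ne']
  exact (abs_convDen_sub_le hB j).2

theorem scaledGapBound_eq {B : ℕ} (hB : 1 ≤ B) :
    scaledGapBound B = (((B + 1) / 2 : ℕ) + maxTail B + 1) *
      (B - ((B + 1) / 2 : ℕ) + maxTail B + 1) /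
        ((((B + 1) / 2 : ℕ) + maxTail B) + (B - ((B + 1) / 2 : ℕ) + maxTail B)) := by
  have h : ((B / 2 : ℕ) : ℝ) = B - ((B + 1) / 2 : ℕ) := by
    have : ((B / 2 + (B + 1) / 2 : ℕ) : ℝ) = B := by
      congr 1; omega
    push_cast at this ⊢
    linarith
  rw [extremal_value hB, scaledGapBound, sqrt_eq_maxTail, Nat.cast_mul, h, mul_comm (_ - _)]

/-- Along `θ = [0; 1, B, 1, B, …]`, with `k` odd and `m = ⌈B / 2⌉`, the bound is approached. -/
theorem tendsto_mul_convErr {B : ℕ} (hB : 1 ≤ B) :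
    Filter.Tendsto (fun j : ℕ =>
      ((((B + 1) / 2 : ℕ) + 1) * convDen (maxTail B) (2 * j + 2) +
          convDen (maxTail B) (2 * j + 1) - 2 : ℝ) *
        (convErr (maxTail B) (2 * j + 1) -
          (((B + 1) / 2 : ℕ) - 1) * convErr (maxTail B) (2 * j + 2)))
      Filter.atTop (nhds (scaledGapBound B)) := by
  have hξ := maxTail_pos hB
  have hθ := irrational_maxTail hB
  have hx := tendsto_convDen_div hB
  have hs := tendsto_inv_convDen hθ
  have hB' : (1 : ℝ) ≤ B := by exact_mod_cast hB
  rw [scaledGapBound_eq hB]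
  set m := (B + 1) / 2
  have hlim := ((((hx.const_add (m : ℝ)).add_const 1).sub (hs.const_mul 2)).mul_const
      (B - m + maxTail B + 1)).div
    ((hx.const_add (m : ℝ)).add_const (B - m + maxTail B)) (by linarith)
  rw [mul_zero, sub_zero] at hlim
  refine hlim.congr fun j => ?_
  have h := mul_convErr_eq hθ (2 * j + 1) m
  have hg : gaussIter (maxTail B) (2 * j + 1 + 1) = maxTail B := (gaussIter_maxTail hB (j + 1)).1
  rw [(partQuot_maxTail hB j).2, hg] at h
  exact h.symm

theorem supScaledGap_eq {B : ℕ} (hB : 1 ≤ B) : supScaledGap B = (scaledGapBound B : EReal) := by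
  refine le_antisymm ?_ ?_
  · exact iSup₂_le fun θ hθ => iSup₂_le fun N _ =>
      EReal.coe_le_coe_iff.2 (mul_largestGap_le hB hθ N)
  · have hθ := maxTail_mem hB
    refine le_of_tendsto' (continuous_coe_real_ereal.continuousAt.tendsto.comp
      (tendsto_mul_convErr hB)) fun j => ?_
    set m := (B + 1) / 2 with hm
    have hma : m ≤ partQuot (maxTail B) (2 * j + 1) := by
      rw [(partQuot_maxTail hB j).2]; omega
    have h1 : 1 ≤ convDen (maxTail B) (2 * j + 1) := convDen_pos hθ.1 (2 * j)
    have h2 : 1 ≤ convDen (maxTail B) (2 * j + 2) := convDen_pos hθ.1 (2 * j + 1)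
    have h3 := Nat.mul_le_mul (show 2 ≤ m + 1 by omega) h2
    obtain ⟨N, hN⟩ : ∃ N, N + 2 = (m + 1) * convDen (maxTail B) (2 * j + 2) +
        convDen (maxTail B) (2 * j + 1) := ⟨_, Nat.sub_add_cancel (by omega)⟩
    have hNR : (N : ℝ) = (m + 1) * convDen (maxTail B) (2 * j + 2) +
        convDen (maxTail B) (2 * j + 1) - 2 := by
      rw [eq_sub_iff_add_eq]; exact_mod_cast hN
    have hgap := convErr_le_largestGap hθ.1 (k := 2 * j + 1) (show 1 ≤ m by omega) hma hN
    refine le_trans ?_ (le_iSup₂_of_le (maxTail B) hθ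
      (le_iSup₂_of_le N (by omega) le_rfl))
    simp only [Function.comp_apply]
    rw [EReal.coe_le_coe_iff, ← hNR]
    exact mul_le_mul_of_nonneg_left hgap (Nat.cast_nonneg N)

/-! ### The two parities -/

theorem theorem4 (B : ℕ) (hB : 1 ≤ B) :
    (∀ a : ℕ, B = 2 * a →
      supScaledGap B =
        ((1 + ((a : ℝ) + 1) ^ 2 / (2 * Real.sqrt ((a : ℝ) ^ 2 + 2 * (a : ℝ))) : ℝ) : EReal)) ∧
    (∀ a : ℕ, B = 2 * a + 1 →
      supScaledGap B =
        ((1 + ((a : ℝ) ^ 2 + 3 * (a : ℝ) + 2) /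
          Real.sqrt (4 * (a : ℝ) ^ 2 + 12 * (a : ℝ) + 5) : ℝ) : EReal)) := by
  rw [supScaledGap_eq hB, scaledGapBound]
  constructor
  · rintro a rfl
    have hsqrt : √(((2 * a : ℕ) : ℝ) ^ 2 + 4 * (2 * a : ℕ)) = 2 * √((a : ℝ) ^ 2 + 2 * a) := by
      rw [show ((2 * a : ℕ) : ℝ) ^ 2 + 4 * (2 * a : ℕ) = 2 ^ 2 * ((a : ℝ) ^ 2 + 2 * a) by
        push_cast; ring, Real.sqrt_mul (by positivity), Real.sqrt_sq (by norm_num)]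
    rw [hsqrt, show 2 * a / 2 = a by omega, show (2 * a + 1) / 2 = a by omega]
    push_cast
    ring_nf
  · rintro a rfl
    rw [show (2 * a + 1) / 2 = a by omega, show (2 * a + 1 + 1) / 2 = a + 1 by omega]
    push_cast
    ring_nf
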